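/- **Setting.** Let $n\ge 1$ and $m\ge 0$ be integers, and consider real- or complex-valued functions on $\mathbb{R}^n$. Let $\mathcal{Q}$ be the set of all (half-open) cubes in $\mathbb{R}^n$ with sides parallel to the axes. For $Q\in\mathcal{Q}$ let $\mathcal{D}(Q)$ be the family of dyadic cubes with respect to $Q$, i.e. the cubes obtained by repeatedly subdividing $Q$ and its descendants into $2^n$ congruent subcubes ($Q$ itself included). For $f\in L^1_{\mathrm{loc}}(\mathbb{R}^n)$ let $P_Qf$ be the projection of $f$ on $Q$ onto the polynomials of degree at most $m$, i.e. the unique polynomial of degree at most $m$ such that $\int_Q (f-P_Qf)\,\pi=0$ for all polynomials $\pi$ of degree at most $m$. A *Banach function norm* over a measure $\mu$ on $\mathbb{R}^n$ is a map $\rho$ from the $[0,\infty]$-valued $\mu$-measurable functions to $[0,\infty]$ such that $\rho(u)=0$ iff $u=0$ $\mu$-a.e., $\rho(cu)=c\,\rho(u)$ for $c\in[0,\infty)$, $\rho(u+v)\le\rho(u)+\rho(v)$, $\rho(u)\le\rho(v)$ if $u\le v$ $\mu$-a.e., and $\rho\big(\sum_k u_k\big)<\infty$ whenever $\sum_{k}\rho(u_k)<\infty$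 (Riesz–Fischer property, i.e. completeness). We write $\|g\|_{X}=\rho(|g|)$. For every $Q\in\mathcal{Q}$ let $\|\cdot\|_{X_Q}$ be a Banach function norm over a measure $\mu_Q$ which is absolutely continuous with respect to Lebesgue measure (for instance Lebesgue measure itself, or $w\,\mathrm{d}x$ on $Q$ for a weight $w$). Let $\varphi\colon[0,1]\to[0,\infty)$ be increasing (in the wide sense). A functional $a\colon\mathcal{Q}\to[0,\infty)$ satisfies the *$\varphi$-smallness preserving condition* if for every $Q\in\mathcal{Q}$ and every family $\{Q_j\}\subset\mathcal{D}(Q)$ of pairwise disjoint cubes $$\Big\|\sum_j a(Q_j)\chi_{Q_j}\Big\|_{X_Q}\le \varphi\Big(\frac{\sum_j|Q_j|}{|Q|}\Big)\,a(Q).$$ **Theorem.** There is a finite constant $C_{n,m}>0$, depending only on $n$ and $m$ (and on whether the scalars are real or complex), such that the following holds. Let $f\in L^1_{\mathrm{loc}}(\mathbb{R}^n)$, and let $\{X_Q\}_{Q \in \mathcal{Q}}$, $\varphi$ and $a$ be as above, where $a$ satisfies the $\varphi$-smallness preserving condition and $$\frac1{|Q|}\int_Q|f-P_Qf|\le a(Q)\qquad\text{for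 all }Q\in\mathcal{Q}.$$ Then for all $Q\in\mathcal{Q}$ $$\|(f-P_Qf)\chi_Q\|_{X_Q}\le C_{n,m}\,a(Q)\Big(\int_0^1\varphi(t)\,\frac{\mathrm{d}t}{t}+\varphi(1)\Big).$$ Here the integral may be infinite, and $0\cdot\infty=0$. -/

import Mathlib

open MeasureTheory
open scoped ENNReal NNReal

/-- A cube in `ℝⁿ` with sides parallel to the axes, given by its lower corner and its
(positive) side length. -/
structure AxisCube (n : ℕ) where
  corner : Fin n → ℝ
  side : ℝ
  side_pos : 0 < side

namespace AxisCube

variable {n : ℕ}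

/-- The points of a cube. Cubes are half-open, so that the `2ⁿ` congruent subcubes into which a cube
is subdivided are pairwise disjoint and cover it. -/
def toSet (Q : AxisCube n) : Set (Fin n → ℝ) :=
  Set.univ.pi fun i => Set.Ico (Q.corner i) (Q.corner i + Q.side)

/-- The family `𝒟(Q)` of dyadic cubes with respect to `Q`: the cubes obtained after `k ≥ 0` rounds of
subdivision of `Q` into `2ⁿ` congruent subcubes. -/
def dyadic (Q : AxisCube n) : Set (AxisCube n) :=
  {P | ∃ (k : ℕ) (j : Fin n → Fin (2 ^ k)),
    P.side = Q.side / 2 ^ k ∧ ∀ i, P.corner i = Q.corner i + (j i : ℕ) * (Q.side / 2 ^ k)}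

theorem measurableSet_toSet (Q : AxisCube n) : MeasurableSet Q.toSet :=
  MeasurableSet.univ_pi fun _ => measurableSet_Ico

end AxisCube

/-- A Banach function norm on the `[0, ∞]`-valued measurable functions on a measure space: a function
norm (definite, positively homogeneous, subadditive and monotone, all in the a.e. sense) with the
Riesz–Fischer property, which is equivalent to completeness of the associated normed function space
(and is implied by the Fatou property). The value on functions that are not a.e.-measurable is
irrelevant. -/
structure BanachFunctionNorm {α : Type*} [MeasurableSpace α] (μ : Measure α) where
  toFun : (α → ℝ≥0∞) → ℝ≥0∞
  eq_zero_iff : ∀ u, AEMeasurable u μ → (toFun u = 0 ↔ u =ᵐ[μ] 0)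
  smul_eq : ∀ (c : ℝ≥0) (u), AEMeasurable u μ → toFun (fun x => c * u x) = c * toFun u
  add_le : ∀ u v, AEMeasurable u μ → AEMeasurable v μ →
    toFun (fun x => u x + v x) ≤ toFun u + toFun v
  mono : ∀ u v, AEMeasurable u μ → AEMeasurable v μ → u ≤ᵐ[μ] v → toFun u ≤ toFun v
  riesz_fischer : ∀ u : ℕ → α → ℝ≥0∞, (∀ k, AEMeasurable (u k) μ) →
    ∑' k, toFun (u k) < ∞ → toFun (fun x => ∑' k, u k x) < ∞

instance {α : Type*} [MeasurableSpace α] (μ : Measure α) :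
    CoeFun (BanachFunctionNorm μ) (fun _ => (α → ℝ≥0∞) → ℝ≥0∞) :=
  ⟨BanachFunctionNorm.toFun⟩

section Projection

variable {n : ℕ} {𝕜 : Type*} [RCLike 𝕜]

/-- The value at a point of `ℝⁿ` of a polynomial in `n` variables with coefficients in `𝕜`. -/
noncomputable def polyEval (p : MvPolynomial (Fin n) 𝕜) (x : Fin n → ℝ) : 𝕜 :=
  MvPolynomial.eval (fun i => (x i : 𝕜)) p

/-- `p` is the projection of `f` onto the polynomials of degree at most `m` on the cube `Q`: it has
degree at most `m`, and `f - p` is orthogonal on `Q` to every polynomial of degree at most `m`.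
(No conjugate is needed, as these polynomials are closed under conjugation of coefficients.) -/
def IsPolyProj (m : ℕ) (Q : AxisCube n) (f : (Fin n → ℝ) → 𝕜) (p : MvPolynomial (Fin n) 𝕜) :
    Prop :=
  p.totalDegree ≤ m ∧ ∀ q : MvPolynomial (Fin n) 𝕜, q.totalDegree ≤ m →
    ∫ x in Q.toSet, (f x - polyEval p x) * polyEval q x = 0

open Classical in
/-- The polynomial projection `P_Q f`. For `f` integrable on `Q` it exists and is unique, see
`existsUnique_isPolyProj`. -/
noncomputable def polyProj (m : ℕ) (Q : AxisCube n) (f : (Fin n → ℝ) → 𝕜) :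
    MvPolynomial (Fin n) 𝕜 :=
  if h : ∃ p, IsPolyProj m Q f p then h.choose else 0

theorem continuous_polyEval (p : MvPolynomial (Fin n) 𝕜) : Continuous (polyEval p) := by
  unfold polyEval
  exact (MvPolynomial.continuous_eval p).comp (by fun_prop)

theorem AxisCube.toSet_subset_Icc (Q : AxisCube n) :
    Q.toSet ⊆ Set.Icc Q.corner (fun i => Q.corner i + Q.side) := by
  intro x hx
  exact ⟨fun i => (hx i trivial).1, fun i => (hx i trivial).2.le⟩

theorem integrableOn_mul_polyEval {Q : AxisCube n} {f : (Fin n → ℝ) → 𝕜}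
    (hf : IntegrableOn f Q.toSet) (q : MvPolynomial (Fin n) 𝕜) :
    IntegrableOn (fun x => f x * polyEval q x) Q.toSet := by
  obtain ⟨C, hC⟩ := (isCompact_Icc (a := Q.corner)
    (b := fun i => Q.corner i + Q.side)).exists_bound_of_continuousOn
      (continuous_polyEval q).continuousOn
  refine Integrable.mul_bdd (c := C) hf (continuous_polyEval q).aestronglyMeasurable ?_
  filter_upwards [ae_restrict_mem Q.measurableSet_toSet] with x hx
  exact hC x (Q.toSet_subset_Icc hx)

theorem integrableOn_polyEval (Q : AxisCube n) (p : MvPolynomial (Fin n) 𝕜) :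
    IntegrableOn (polyEval p) Q.toSet :=
  ((continuous_polyEval p).integrableOn_Icc).mono_set Q.toSet_subset_Icc

theorem eq_zero_of_forall_integral_eq_zero (Q : AxisCube n) {m : ℕ}
    {p : MvPolynomial (Fin n) 𝕜} (hp : p.totalDegree ≤ m)
    (h : ∀ q : MvPolynomial (Fin n) 𝕜, q.totalDegree ≤ m →
      ∫ x in Q.toSet, polyEval p x * polyEval q x = 0) : p = 0 := by
  have hconj (x : Fin n → ℝ) :
      polyEval (MvPolynomial.map (starRingEnd 𝕜) p) x = starRingEnd 𝕜 (polyEval p x) := by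
    unfold polyEval
    rw [MvPolynomial.eval_map, ← MvPolynomial.coe_eval₂Hom, MvPolynomial.eval,
      MvPolynomial.coe_eval₂Hom, MvPolynomial.coe_eval₂Hom, MvPolynomial.eval₂_comp_left]
    congr 1
    funext i
    simp
  have h1 := h (MvPolynomial.map (starRingEnd 𝕜) p)
    ((Finset.sup_mono (MvPolynomial.support_map_subset _ _)).trans hp)
  have h2 : ∫ x in Q.toSet, ‖polyEval p x‖ ^ 2 = 0 := by
    have : ∀ x, polyEval p x * polyEval (MvPolynomial.map (starRingEnd 𝕜) p) x
        = ((‖polyEval p x‖ ^ 2 : ℝ) : 𝕜) := by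
      intro x
      rw [hconj, RCLike.mul_conj]; push_cast; rfl
    simp_rw [this] at h1
    rw [integral_ofReal] at h1
    exact_mod_cast h1
  have hint : IntegrableOn (fun x => ‖polyEval p x‖ ^ 2) Q.toSet :=
    (((continuous_polyEval p).norm.pow 2).integrableOn_Icc).mono_set Q.toSet_subset_Icc
  rw [integral_eq_zero_iff_of_nonneg (fun x => by positivity) hint] at h2
  have hae : polyEval p =ᵐ[volume.restrict
      (Set.univ.pi fun i => Set.Ioo (Q.corner i) (Q.corner i + Q.side))] fun _ => 0 := by
    refine ae_restrict_of_ae_restrict_of_subset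
      (Set.pi_mono fun i _ => Set.Ioo_subset_Ico_self) ?_
    filter_upwards [h2] with x hx
    simpa using hx
  have heq := Measure.eqOn_open_of_ae_eq hae
    (isOpen_set_pi Set.finite_univ fun i _ => isOpen_Ioo)
    (continuous_polyEval p).continuousOn continuousOn_const
  refine MvPolynomial.funext_set
    (fun i => (fun t : ℝ => (t : 𝕜)) '' Set.Ioo (Q.corner i) (Q.corner i + Q.side)) (fun i => ?_) ?_
  · exact (Set.Ioo_infinite (by linarith [Q.side_pos])).image RCLike.ofReal_injective.injOn
  · intro y hy
    choose x hx hxy using fun i => hy i trivial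
    have : y = fun i => (x i : 𝕜) := funext fun i => (hxy i).symm
    rw [this, map_zero]
    exact heq (fun i _ => hx i)

theorem existsUnique_isPolyProj (m : ℕ) (Q : AxisCube n) {f : (Fin n → ℝ) → 𝕜}
    (hf : IntegrableOn f Q.toSet) : ∃! p, IsPolyProj m Q f p := by
  have hpq (p q : MvPolynomial (Fin n) 𝕜) :
      IntegrableOn (fun x => polyEval p x * polyEval q x) Q.toSet :=
    integrableOn_mul_polyEval (integrableOn_polyEval Q p) q
  have hadd (p q : MvPolynomial (Fin n) 𝕜) (x) :
      polyEval (p + q) x = polyEval p x + polyEval q x := by simp [polyEval]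
  have hsmul (c : 𝕜) (p : MvPolynomial (Fin n) 𝕜) (x) :
      polyEval (c • p) x = c * polyEval p x := by simp [polyEval]
  have hiff (p q : MvPolynomial (Fin n) 𝕜) :
      ∫ x in Q.toSet, (f x - polyEval p x) * polyEval q x = 0 ↔
        ∫ x in Q.toSet, polyEval p x * polyEval q x = ∫ x in Q.toSet, f x * polyEval q x := by
    simp_rw [sub_mul]
    rw [integral_sub (integrableOn_mul_polyEval hf q) (hpq p q), sub_eq_zero, eq_comm]
  let V := MvPolynomial.restrictTotalDegree (Fin n) 𝕜 m
  let B : V →ₗ[𝕜] Module.Dual 𝕜 V := LinearMap.mk₂ 𝕜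
    (fun p q => ∫ x in Q.toSet, polyEval p.1 x * polyEval q.1 x)
    (fun p p' q => by
      simp only [Submodule.coe_add, hadd, add_mul]; exact integral_add (hpq _ _) (hpq _ _))
    (fun c p q => by
      simp only [Submodule.coe_smul, hsmul, mul_assoc, smul_eq_mul]
      exact integral_const_mul _ _)
    (fun p q q' => by
      simp only [Submodule.coe_add, hadd, mul_add]; exact integral_add (hpq _ _) (hpq _ _))
    (fun c p q => by
      simp only [Submodule.coe_smul, hsmul, mul_left_comm _ c, smul_eq_mul]
      exact integral_const_mul _ _)
  let L : Module.Dual 𝕜 V :=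
    { toFun := fun q => ∫ x in Q.toSet, f x * polyEval q.1 x
      map_add' := fun q q' => by
        simp only [Submodule.coe_add, hadd, mul_add]
        exact integral_add (integrableOn_mul_polyEval hf _) (integrableOn_mul_polyEval hf _)
      map_smul' := fun c q => by
        simp only [Submodule.coe_smul, hsmul, mul_left_comm _ c, smul_eq_mul, RingHom.id_apply]
        exact integral_const_mul _ _ }
  have hmem (q : MvPolynomial (Fin n) 𝕜) : q ∈ V ↔ q.totalDegree ≤ m :=
    MvPolynomial.mem_restrictTotalDegree _ _ _
  have hinj : Function.Injective B := by
    rw [← LinearMap.ker_eq_bot, LinearMap.ker_eq_bot']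
    intro p hp
    refine Subtype.ext (eq_zero_of_forall_integral_eq_zero Q ((hmem _).1 p.2) fun q hq => ?_)
    exact LinearMap.congr_fun hp ⟨q, (hmem q).2 hq⟩
  have hsurj : Function.Surjective B :=
    (LinearMap.injective_iff_surjective_of_finrank_eq_finrank
      (Subspace.dual_finrank_eq (K := 𝕜) (V := V)).symm).1 hinj
  obtain ⟨p, hp⟩ := hsurj L
  refine ⟨p.1, ⟨(hmem _).1 p.2, fun q hq => ?_⟩, fun p' hp' => ?_⟩
  · rw [hiff]
    exact LinearMap.congr_fun hp ⟨q, (hmem q).2 hq⟩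
  · have : (⟨p', (hmem _).2 hp'.1⟩ : V) = p := by
      refine hinj (LinearMap.ext fun q => ?_)
      rw [hp]
      exact (hiff _ _).1 (hp'.2 q.1 ((hmem _).1 q.2))
    exact congrArg Subtype.val this

theorem isPolyProj_polyProj (m : ℕ) (Q : AxisCube n) {f : (Fin n → ℝ) → 𝕜}
    (hf : IntegrableOn f Q.toSet) : IsPolyProj m Q f (polyProj m Q f) := by
  have h := (existsUnique_isPolyProj m Q hf).exists
  rw [polyProj, dif_pos h]
  exact h.choose_spec

end Projection

/-- The `φ`-smallness preserving condition for a functional `a` on cubes, with respect to a family of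
Banach function norms indexed by the cubes. Only the values of `φ` on `[0, 1]` matter. -/
def SmallnessPreserving {n : ℕ} {μ : AxisCube n → Measure (Fin n → ℝ)}
    (X : ∀ Q, BanachFunctionNorm (μ Q)) (φ : ℝ → ℝ≥0) (a : AxisCube n → ℝ≥0) : Prop :=
  ∀ (Q : AxisCube n) (F : Set (AxisCube n)), F ⊆ Q.dyadic → F.PairwiseDisjoint AxisCube.toSet →
    X Q (fun x => ∑' P : F, (P : AxisCube n).toSet.indicator (fun _ => (a P : ℝ≥0∞)) x) ≤
      φ ((∑' P : F, volume (P : AxisCube n).toSet) / volume Q.toSet).toReal * a Q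

/-!
The proof is a Calderón–Zygmund decomposition in the style of John and Nirenberg, combined with
countable subadditivity of Banach function norms.

On a cube `Q`, stop at the largest dyadic subcubes `P` over which the mean of `|f - P_Q f|`
exceeds `2 a(Q)`. As the mean over `Q` is at most `a(Q)`, these bad cubes cover at most half of `Q`
(`tsum_volume_badCubes_le`). Outside of them, `|f - P_Q f| ≤ 2 a(Q)` a.e. by Lebesgue's
differentiation theorem. On a bad cube `P`, the polynomial `P_P f - P_Q f` is the projection
of `f - P_Q f` on `P`. Since projections are bounded from normalized `L¹` to the maximum norm
uniformly in the cube (`exists_norm_polyEval_le_of_isPolyProj`: all norms on the polynomials of degree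
at most `m` are equivalent, and affine maps reduce every cube to the unit cube), this polynomial is at
most a multiple of `a(Q)` on `P`. Hence `|f - P_Q f| ≤ C a(Q) + |f - P_P f|` on `P`
(`exists_ae_enorm_sub_polyProj_le`).

Iterating yields generations `F₀ = {Q}, F₁, F₂, …` of pairwise disjoint dyadic cubes, where `F_k` has
total volume at most `2⁻ᵏ |Q|`, and almost everywhere on `Q`
`|f - P_Q f| ≤ C ∑ₖ ∑_{P ∈ F_k} a(P) χ_P` (`exists_ae_enorm_sub_polyProj_le_tsum`). The smallness
preserving condition bounds the norm of the `k`-th inner sum by `φ(2⁻ᵏ) a(Q)`. The norm of the outer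
sum is at most the sum of the norms (`BanachFunctionNorm.tsum_le`), and by monotonicity of `φ`
the sum `∑ₖ φ(2⁻ᵏ)` is at most `φ(1) + 2 ∫₀¹ φ(t) dt/t` (`tsum_le_two_mul_lintegral_div`).
-/

/-! ### Countable subadditivity of Banach function norms -/

namespace BanachFunctionNorm

variable {α : Type*} [MeasurableSpace α] {μ : Measure α} (ρ : BanachFunctionNorm μ)

theorem map_zero : ρ (fun _ => 0) = 0 :=
  (ρ.eq_zero_iff _ aemeasurable_const).2 Filter.EventuallyEq.rfl

theorem sum_le {u : ℕ → α → ℝ≥0∞} (hu : ∀ k, AEMeasurable (u k) μ) (N : ℕ) :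
    ρ (fun x => ∑ k ∈ Finset.range N, u k x) ≤ ∑ k ∈ Finset.range N, ρ (u k) := by
  induction N with
  | zero => simp [ρ.map_zero]
  | succ N ih =>
    simp only [Finset.sum_range_succ]
    exact (ρ.add_le _ _ (Finset.aemeasurable_fun_sum _ fun k _ => hu k) (hu N)).trans
      (by gcongr)

/-- Countable subadditivity. The Riesz–Fischer property is only qualitative, but it can be applied
to the sum `v = ∑ⱼ ∑_{k ≥ Nⱼ} uₖ` with `Nⱼ` growing so fast that `∑ⱼ ∑_{k ≥ Nⱼ} ρ(uₖ) < ∞`. Then `v`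
dominates arbitrarily large multiples of tails of `∑ uₖ`, so these tails tend to zero in norm. -/
theorem tsum_le {u : ℕ → α → ℝ≥0∞} (hu : ∀ k, AEMeasurable (u k) μ) :
    ρ (fun x => ∑' k, u k x) ≤ ∑' k, ρ (u k) := by
  by_cases hfin : ∑' k, ρ (u k) = ∞
  · rw [hfin]; exact le_top
  obtain ⟨ε, hε, hεsum⟩ := ENNReal.exists_pos_sum_of_countable' (one_ne_zero (α := ℝ≥0∞)) ℕ
  have htail : ∀ j, ∃ N, ∑' k, ρ (u (k + N)) ≤ ε j := fun j =>
    ((ENNReal.tendsto_sum_nat_add (fun k => ρ (u k)) hfin).eventually_le_const (hε j)).exists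
  choose N hN using htail
  let v : α → ℝ≥0∞ := fun x => ∑' j, ∑' k, u (k + N j) x
  have hvm : AEMeasurable v μ :=
    AEMeasurable.tsum fun j => AEMeasurable.tsum fun k => hu _
  have hv : ρ v < ∞ := by
    let e := Nat.pairEquiv.symm
    have h := ρ.riesz_fischer (fun i => u ((e i).2 + N (e i).1)) (fun _ => hu _) ?_
    · convert h using 2
      funext x
      rw [e.tsum_eq (fun q : ℕ × ℕ => u (q.2 + N q.1) x), ENNReal.tsum_prod']
    · rw [e.tsum_eq (fun q : ℕ × ℕ => ρ (u (q.2 + N q.1))), ENNReal.tsum_prod']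
      exact ((ENNReal.tsum_le_tsum hN).trans_lt hεsum).trans ENNReal.one_lt_top
  refine ENNReal.le_of_forall_pos_le_add fun δ hδ _ => ?_
  have hδ0 : (δ : ℝ≥0∞) ≠ 0 := by exact_mod_cast hδ.ne'
  obtain ⟨J, hJ⟩ := ENNReal.exists_nat_gt (ENNReal.div_ne_top hv.ne hδ0)
  let M := (Finset.range J).sup N
  let r : α → ℝ≥0∞ := fun x => ∑' k, u (k + M) x
  have hrm : AEMeasurable r μ := AEMeasurable.tsum fun k => hu _
  have hr : (J : ℝ≥0∞) * ρ r ≤ ρ v := by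
    have h := ρ.smul_eq (J : ℝ≥0) r hrm
    rw [show (((J : ℝ≥0) : ℝ≥0∞)) = (J : ℝ≥0∞) by simp] at h
    rw [← h]
    refine ρ.mono _ _ (hrm.const_mul _) hvm (Filter.Eventually.of_forall fun x => ?_)
    calc (J : ℝ≥0∞) * r x = ∑ j ∈ Finset.range J, r x := by simp
      _ ≤ ∑ j ∈ Finset.range J, ∑' k, u (k + N j) x := by
        refine Finset.sum_le_sum fun j hj => ?_
        have hle : N j ≤ M := Finset.le_sup (f := N) hj
        obtain ⟨d, hd⟩ := Nat.exists_eq_add_of_le hle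
        have : r x = ∑' k, (fun i => u (i + N j) x) (k + d) := by
          simp only [r, hd]
          exact tsum_congr fun k => by rw [add_assoc, add_comm d]
        rw [this]
        exact ENNReal.tsum_comp_le_tsum_of_injective (add_left_injective d) _
      _ ≤ v x := ENNReal.sum_le_tsum _
  have hrδ : ρ r ≤ δ := by
    have hJ0 : (J : ℝ≥0∞) ≠ 0 := (bot_le.trans_lt hJ).ne'
    have h1 : ρ v ≤ J * δ := by
      rw [← ENNReal.div_le_iff hδ0 ENNReal.coe_ne_top]; exact hJ.le
    exact (ENNReal.mul_le_mul_iff_right hJ0 (ENNReal.natCast_ne_top J)).1 (hr.trans h1)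
  have hsplit : (fun x => ∑' k, u k x) = fun x => (∑ k ∈ Finset.range M, u k x) + r x :=
    funext fun x => (ENNReal.summable.sum_add_tsum_nat_add' (f := fun k => u k x)).symm
  rw [hsplit]
  refine (ρ.add_le _ _ (Finset.aemeasurable_fun_sum _ fun k _ => hu k) hrm).trans ?_
  gcongr
  exact (ρ.sum_le hu M).trans (ENNReal.sum_le_tsum _)

end BanachFunctionNorm

/-! ### Dyadic cubes -/

namespace AxisCube

variable {n : ℕ}

attribute [ext] AxisCube

theorem volume_toSet (Q : AxisCube n) : volume Q.toSet = ENNReal.ofReal Q.side ^ n := by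
  simp [toSet, volume_pi_pi]

theorem volume_toSet_pos (Q : AxisCube n) : volume Q.toSet ≠ 0 := by
  rw [volume_toSet]
  exact pow_ne_zero _ (by simpa using Q.side_pos)

theorem volume_toSet_ne_top (Q : AxisCube n) : volume Q.toSet ≠ ∞ := by
  rw [volume_toSet]
  exact ENNReal.pow_ne_top ENNReal.ofReal_ne_top

theorem self_mem_dyadic (Q : AxisCube n) : Q ∈ Q.dyadic :=
  ⟨0, fun _ => 0, by simp, by simp⟩

theorem dyadic_trans {P Q R : AxisCube n} (hP : P ∈ Q.dyadic) (hR : R ∈ P.dyadic) :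
    R ∈ Q.dyadic := by
  obtain ⟨k, j, hs, hc⟩ := hP
  obtain ⟨l, i, hs', hc'⟩ := hR
  refine ⟨k + l, fun t => ⟨j t * 2 ^ l + i t, ?_⟩, ?_, fun t => ?_⟩
  · have h1 := (j t).2
    have h2 := (i t).2
    calc (j t : ℕ) * 2 ^ l + i t < j t * 2 ^ l + 2 ^ l := by omega
      _ = (j t + 1) * 2 ^ l := by ring
      _ ≤ 2 ^ k * 2 ^ l := Nat.mul_le_mul_right _ h1
      _ = 2 ^ (k + l) := (pow_add _ _ _).symm
  · rw [hs', hs, pow_add, div_div]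
  · rw [hc', hc, hs]
    push_cast
    rw [pow_add]
    field_simp
    ring

theorem countable_dyadic (Q : AxisCube n) : Q.dyadic.Countable := by
  have h : Q.dyadic ⊆ Set.range (fun p : Σ k, (Fin n → Fin (2 ^ k)) =>
      (⟨fun i => Q.corner i + (p.2 i : ℕ) * (Q.side / 2 ^ p.1), Q.side / 2 ^ p.1,
        div_pos Q.side_pos (by positivity)⟩ : AxisCube n)) := by
    rintro P ⟨k, j, hs, hc⟩
    exact ⟨⟨k, j⟩, AxisCube.ext (funext fun i => (hc i).symm) hs.symm⟩
  exact (Set.countable_range _).mono h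

theorem toSet_subset_of_mem_dyadic {P Q : AxisCube n} (hP : P ∈ Q.dyadic) :
    P.toSet ⊆ Q.toSet := by
  obtain ⟨k, j, hs, hc⟩ := hP
  intro x hx i _
  obtain ⟨h1, h2⟩ := hx i trivial
  rw [hc] at h1 h2
  rw [hs] at h2
  have hd : 0 < Q.side / 2 ^ k := div_pos Q.side_pos (by positivity)
  have hj : ((j i : ℕ) : ℝ) + 1 ≤ 2 ^ k := by exact_mod_cast (j i).2
  have hmul : ((j i : ℕ) + 1 : ℝ) * (Q.side / 2 ^ k) ≤ 2 ^ k * (Q.side / 2 ^ k) := by gcongr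
  have hcancel : (2 : ℝ) ^ k * (Q.side / 2 ^ k) = Q.side := by field_simp
  constructor
  · have : 0 ≤ ((j i : ℕ) : ℝ) * (Q.side / 2 ^ k) := by positivity
    linarith
  · linarith

/-- The position of the point `x` in the grid of mesh `Q.side / 2 ^ k` anchored at the corner
of `Q`. -/
noncomputable def gridIndex (Q : AxisCube n) (k : ℕ) (x : Fin n → ℝ) (i : Fin n) : ℤ :=
  ⌊(x i - Q.corner i) / Q.side * 2 ^ k⌋

/-- The cube of side `Q.side / 2 ^ k` containing `x` in the grid anchored at the corner of `Q`. For
`x ∈ Q` it is the dyadic cube of level `k` with respect to `Q` that contains `x`. -/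
noncomputable def cubeAt (Q : AxisCube n) (k : ℕ) (x : Fin n → ℝ) : AxisCube n where
  corner i := Q.corner i + Q.gridIndex k x i * (Q.side / 2 ^ k)
  side := Q.side / 2 ^ k
  side_pos := div_pos Q.side_pos (by positivity)

theorem mem_cubeAt_iff {Q : AxisCube n} {k : ℕ} {x y : Fin n → ℝ} :
    y ∈ (Q.cubeAt k x).toSet ↔ Q.gridIndex k y = Q.gridIndex k x := by
  have hQ := Q.side_pos
  have h2 : (0 : ℝ) < 2 ^ k := by positivity
  simp only [toSet, Set.mem_univ_pi, Set.mem_Ico, cubeAt, funext_iff]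
  refine forall_congr' fun i => ?_
  generalize Q.gridIndex k x i = a
  rw [gridIndex, Int.floor_eq_iff, div_mul_eq_mul_div, le_div_iff₀ hQ, div_lt_iff₀ hQ]
  have e1 : (a : ℝ) * (Q.side / 2 ^ k) = a * Q.side / 2 ^ k := by ring
  have e2 : Q.corner i + a * (Q.side / 2 ^ k) + Q.side / 2 ^ k
      = Q.corner i + (a + 1) * Q.side / 2 ^ k := by ring
  rw [e2, e1, ← le_sub_iff_add_le', div_le_iff₀ h2, ← sub_lt_iff_lt_add', lt_div_iff₀ h2]

theorem mem_cubeAt_self (Q : AxisCube n) (k : ℕ) (x : Fin n → ℝ) : x ∈ (Q.cubeAt k x).toSet :=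
  mem_cubeAt_iff.2 rfl

theorem cubeAt_eq_of_mem {Q : AxisCube n} {k : ℕ} {x y : Fin n → ℝ}
    (h : y ∈ (Q.cubeAt k x).toSet) : Q.cubeAt k y = Q.cubeAt k x := by
  simp only [cubeAt, mem_cubeAt_iff.1 h]

theorem gridIndex_of_le (Q : AxisCube n) {l k : ℕ} (h : l ≤ k) (x : Fin n → ℝ) (i : Fin n) :
    Q.gridIndex l x i = Q.gridIndex k x i / 2 ^ (k - l) := by
  have : (x i - Q.corner i) / Q.side * 2 ^ l
      = (x i - Q.corner i) / Q.side * 2 ^ k / ((2 ^ (k - l) : ℕ) : ℝ) := by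
    obtain ⟨d, rfl⟩ := Nat.exists_eq_add_of_le h
    rw [Nat.add_sub_cancel_left, pow_add]
    push_cast
    field_simp
  rw [gridIndex, gridIndex, this, Int.floor_div_natCast]
  push_cast
  rfl

theorem cubeAt_subset_of_le (Q : AxisCube n) {l k : ℕ} (h : l ≤ k) (x : Fin n → ℝ) :
    (Q.cubeAt k x).toSet ⊆ (Q.cubeAt l x).toSet := by
  intro y hy
  rw [mem_cubeAt_iff] at hy ⊢
  funext i
  rw [Q.gridIndex_of_le h, Q.gridIndex_of_le h, hy]

theorem cubeAt_mem_dyadic {Q : AxisCube n} {x : Fin n → ℝ} (hx : x ∈ Q.toSet) (k : ℕ) :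
    Q.cubeAt k x ∈ Q.dyadic := by
  have hQ := Q.side_pos
  have hnonneg (i : Fin n) : 0 ≤ Q.gridIndex k x i := by
    have h0 := (hx i trivial).1
    exact Int.floor_nonneg.2 (mul_nonneg (div_nonneg (by linarith) hQ.le) (by positivity))
  have hlt (i : Fin n) : Q.gridIndex k x i < 2 ^ k := by
    have h1 : (x i - Q.corner i) / Q.side < 1 := by
      rw [div_lt_one hQ]; linarith [(hx i trivial).2]
    refine Int.floor_lt.2 ?_
    push_cast
    exact (mul_lt_mul_of_pos_right h1 (by positivity)).trans_eq (one_mul _)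
  refine ⟨k, fun i => ⟨(Q.gridIndex k x i).toNat, ?_⟩, rfl, fun i => ?_⟩
  · have := hlt i
    have := hnonneg i
    zify
    rwa [Int.toNat_of_nonneg this]
  · have : (((Q.gridIndex k x i).toNat : ℕ) : ℝ) = (Q.gridIndex k x i : ℝ) := by
      exact_mod_cast Int.toNat_of_nonneg (hnonneg i)
    simp only [cubeAt, this]

theorem cubeAt_zero {Q : AxisCube n} {x : Fin n → ℝ} (hx : x ∈ Q.toSet) : Q.cubeAt 0 x = Q := by
  obtain ⟨hs, hc⟩ : (Q.cubeAt 0 x).side = Q.side ∧ ∀ i, Q.gridIndex 0 x i = 0 := by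
    refine ⟨by simp [cubeAt], fun i => ?_⟩
    have hQ := Q.side_pos
    obtain ⟨h0, h1⟩ := hx i trivial
    rw [gridIndex, Int.floor_eq_iff]
    simp only [pow_zero, mul_one, Int.cast_zero, zero_add]
    exact ⟨div_nonneg (by linarith) hQ.le, (div_lt_one hQ).2 (by linarith)⟩
  exact AxisCube.ext (funext fun i => by simp [cubeAt, hc]) hs

theorem volume_cubeAt (Q : AxisCube n) (k : ℕ) (x : Fin n → ℝ) :
    volume (Q.cubeAt k x).toSet = 2 ^ n * volume (Q.cubeAt (k + 1) x).toSet := by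
  have : (Q.cubeAt k x).side = 2 * (Q.cubeAt (k + 1) x).side := by
    simp only [cubeAt, pow_succ]; field_simp
  rw [volume_toSet, volume_toSet, this, ENNReal.ofReal_mul (by norm_num), mul_pow]
  norm_num

/-- A half-open cube is, up to a null set, a closed ball of the maximum norm. -/
theorem toSet_ae_eq_closedBall (Q : AxisCube n) :
    Q.toSet =ᵐ[volume] Metric.closedBall (fun i => Q.corner i + Q.side / 2) (Q.side / 2) := by
  have : Metric.closedBall (fun i => Q.corner i + Q.side / 2) (Q.side / 2)
      = Set.univ.pi fun i => Set.Icc (Q.corner i) (Q.corner i + Q.side) := by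
    rw [closedBall_pi _ (by linarith [Q.side_pos])]
    congr 1
    funext i
    rw [Real.closedBall_eq_Icc]
    congr 1 <;> ring
  rw [this]
  exact Measure.ae_eq_set_pi fun i _ => Ico_ae_eq_Icc

/-- Lebesgue's differentiation theorem along the dyadic cubes shrinking to a point. -/
theorem ae_tendsto_average_cubeAt (Q : AxisCube n) {g : (Fin n → ℝ) → ℝ}
    (hg : LocallyIntegrable g) :
    ∀ᵐ x, Filter.Tendsto (fun k => ⨍ y in (Q.cubeAt k x).toSet, g y) Filter.atTop
      (nhds (g x)) := by
  filter_upwards [IsUnifLocDoublingMeasure.ae_tendsto_average volume hg 1] with x hx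
  have hlim : Filter.Tendsto (fun k : ℕ => (Q.cubeAt k x).side / 2) Filter.atTop
      (nhdsWithin 0 (Set.Ioi 0)) := by
    rw [tendsto_nhdsWithin_iff]
    refine ⟨?_, Filter.Eventually.of_forall fun k => half_pos (Q.cubeAt k x).side_pos⟩
    have h := (tendsto_pow_atTop_nhds_zero_of_lt_one (r := (1 / 2 : ℝ)) (by norm_num)
      (by norm_num)).const_mul (Q.side / 2)
    rw [mul_zero] at h
    refine h.congr fun k => ?_
    simp only [cubeAt, one_div, inv_pow]
    ring
  have h := hx (fun k i => (Q.cubeAt k x).corner i + (Q.cubeAt k x).side / 2) _ hlim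
    (Filter.Eventually.of_forall fun k => by
      rw [one_mul, closedBall_pi _ (half_pos (Q.cubeAt k x).side_pos).le]
      intro i _
      obtain ⟨h1, h2⟩ := Q.mem_cubeAt_self k x i trivial
      simp only [Real.closedBall_eq_Icc]
      constructor <;> linarith)
  refine h.congr fun k => ?_
  exact setAverage_congr (Q.cubeAt k x).toSet_ae_eq_closedBall.symm

end AxisCube

/-! ### Polynomial projections are uniformly bounded -/

/-- A linear map on a finite-dimensional space is bounded with respect to any inner product. -/
theorem InnerProductSpace.Core.exists_sq_norm_le {𝕜 V W : Type*} [RCLike 𝕜] [AddCommGroup V]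
    [Module 𝕜 V] [FiniteDimensional 𝕜 V] [NormedAddCommGroup W] [NormedSpace 𝕜 W]
    (core : InnerProductSpace.Core 𝕜 V) (S : V →ₗ[𝕜] W) :
    ∃ C : ℝ, 0 < C ∧ ∀ v, ‖S v‖ ^ 2 ≤ C * RCLike.re (core.inner v v) := by
  let _ : NormedAddCommGroup V := core.toNormedAddCommGroup
  let _ : InnerProductSpace 𝕜 V := InnerProductSpace.ofCore core.toCore
  let T := LinearMap.toContinuousLinearMap S
  refine ⟨‖T‖ ^ 2 + 1, by positivity, fun v => ?_⟩
  have hv : RCLike.re (core.inner v v) = ‖v‖ ^ 2 := inner_self_eq_norm_sq (𝕜 := 𝕜) v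
  have h1 : ‖S v‖ ≤ ‖T‖ * ‖v‖ := T.le_opNorm v
  calc ‖S v‖ ^ 2 ≤ (‖T‖ * ‖v‖) ^ 2 := by gcongr
    _ = ‖T‖ ^ 2 * ‖v‖ ^ 2 := mul_pow _ _ _
    _ ≤ (‖T‖ ^ 2 + 1) * ‖v‖ ^ 2 := by gcongr; linarith
    _ = _ := by rw [hv]

section PolynomialBounds

variable {n : ℕ} {𝕜 : Type*} [RCLike 𝕜]

theorem polyEval_sub (p q : MvPolynomial (Fin n) 𝕜) (x : Fin n → ℝ) :
    polyEval (p - q) x = polyEval p x - polyEval q x := by simp [polyEval]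

theorem polyEval_add (p q : MvPolynomial (Fin n) 𝕜) (x : Fin n → ℝ) :
    polyEval (p + q) x = polyEval p x + polyEval q x := by simp [polyEval]

theorem polyEval_smul (c : 𝕜) (p : MvPolynomial (Fin n) 𝕜) (x : Fin n → ℝ) :
    polyEval (c • p) x = c * polyEval p x := by simp [polyEval]

theorem polyEval_conj (p : MvPolynomial (Fin n) 𝕜) (x : Fin n → ℝ) :
    polyEval (MvPolynomial.map (starRingEnd 𝕜) p) x = starRingEnd 𝕜 (polyEval p x) := by
  unfold polyEval
  rw [MvPolynomial.eval_map, ← MvPolynomial.coe_eval₂Hom, MvPolynomial.eval,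
    MvPolynomial.coe_eval₂Hom, MvPolynomial.coe_eval₂Hom, MvPolynomial.eval₂_comp_left]
  congr 1
  funext i
  simp

theorem totalDegree_conj_le (p : MvPolynomial (Fin n) 𝕜) :
    (MvPolynomial.map (starRingEnd 𝕜) p).totalDegree ≤ p.totalDegree :=
  Finset.sup_mono (MvPolynomial.support_map_subset _ _)

theorem totalDegree_bind₁_le {σ τ R : Type*} [CommSemiring R] {F : σ → MvPolynomial τ R}
    (hF : ∀ i, (F i).totalDegree ≤ 1) (p : MvPolynomial σ R) :
    (MvPolynomial.bind₁ F p).totalDegree ≤ p.totalDegree := by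
  conv_lhs => rw [p.as_sum, map_sum]
  refine MvPolynomial.totalDegree_finsetSum_le fun d hd => ?_
  rw [MvPolynomial.bind₁_monomial]
  refine (MvPolynomial.totalDegree_mul _ _).trans ?_
  rw [MvPolynomial.totalDegree_C, zero_add]
  refine (MvPolynomial.totalDegree_finsetProd _ _).trans ?_
  refine le_trans ?_ (MvPolynomial.le_totalDegree hd)
  refine Finset.sum_le_sum fun i _ => (MvPolynomial.totalDegree_pow _ _).trans ?_
  exact (Nat.mul_le_mul_left _ (hF i)).trans_eq (mul_one _)

theorem integrableOn_norm_polyEval_sq (Q : AxisCube n) (p : MvPolynomial (Fin n) 𝕜) :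
    IntegrableOn (fun x => ‖polyEval p x‖ ^ 2) Q.toSet :=
  (((continuous_polyEval p).norm.pow 2).integrableOn_Icc).mono_set Q.toSet_subset_Icc

theorem integral_conj_mul_self (Q : AxisCube n) (p : MvPolynomial (Fin n) 𝕜) :
    ∫ x in Q.toSet, starRingEnd 𝕜 (polyEval p x) * polyEval p x
      = ((∫ x in Q.toSet, ‖polyEval p x‖ ^ 2 : ℝ) : 𝕜) := by
  rw [← integral_ofReal]
  congr 1
  funext x
  rw [RCLike.conj_mul]; push_cast; rfl

/-- The `L²` inner product over the cube `Q` on the space of polynomials of degree at most `m`. -/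
@[reducible] noncomputable def polyInnerCore (m : ℕ) (Q : AxisCube n) :
    InnerProductSpace.Core 𝕜 (MvPolynomial.restrictTotalDegree (Fin n) 𝕜 m) where
  inner p q := ∫ x in Q.toSet, starRingEnd 𝕜 (polyEval p.1 x) * polyEval q.1 x
  conj_inner_symm p q := by
    rw [← integral_conj]
    congr 1
    funext x
    simp [mul_comm]
  re_inner_nonneg p := by
    rw [integral_conj_mul_self, RCLike.ofReal_re]
    exact integral_nonneg fun x => by positivity
  add_left p q r := by
    have h (p q : MvPolynomial (Fin n) 𝕜) :
        IntegrableOn (fun x => starRingEnd 𝕜 (polyEval p x) * polyEval q x) Q.toSet := by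
      simp only [← polyEval_conj]
      exact integrableOn_mul_polyEval (integrableOn_polyEval Q _) q
    rw [← integral_add (h _ _) (h _ _)]
    simp only [Submodule.coe_add, polyEval_add, map_add, add_mul]
  smul_left p q c := by
    rw [← integral_const_mul]
    simp only [Submodule.coe_smul, polyEval_smul, map_mul, mul_assoc]
  definite p hp := by
    rw [integral_conj_mul_self] at hp
    have h2 : ∫ x in Q.toSet, ‖polyEval p.1 x‖ ^ 2 = 0 := by exact_mod_cast hp
    rw [integral_eq_zero_iff_of_nonneg (fun x => by positivity)
      (integrableOn_norm_polyEval_sq Q p.1)] at h2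
    refine Subtype.ext (eq_zero_of_forall_integral_eq_zero Q
      ((MvPolynomial.mem_restrictTotalDegree _ _ _).1 p.2) fun q _ => ?_)
    refine integral_eq_zero_of_ae ?_
    filter_upwards [h2] with x hx
    have : polyEval p.1 x = 0 := by simpa using hx
    simp [this]

/-- The cube `[0, 1)ⁿ`. -/
def AxisCube.unit (n : ℕ) : AxisCube n := ⟨0, 1, one_pos⟩

/-- On the unit cube, the maximum norm of polynomials of degree at most `m` is bounded by a multiple
of their `L²` norm, because this space of polynomials is finite-dimensional. -/
theorem exists_sq_norm_polyEval_le_unit (𝕜 : Type*) [RCLike 𝕜] (n m : ℕ) :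
    ∃ C : ℝ, 0 < C ∧ ∀ p : MvPolynomial (Fin n) 𝕜, p.totalDegree ≤ m → ∀ x ∈ Set.Icc 0 1,
      ‖polyEval p x‖ ^ 2 ≤ C * ∫ y in (AxisCube.unit n).toSet, ‖polyEval p y‖ ^ 2 := by
  let V := MvPolynomial.restrictTotalDegree (Fin n) 𝕜 m
  let S : V →ₗ[𝕜] C(Set.Icc (0 : Fin n → ℝ) 1, 𝕜) :=
    { toFun := fun p => ⟨fun x => polyEval p.1 x, (continuous_polyEval p.1).comp (by fun_prop)⟩
      map_add' := fun p q => by ext x; simp [polyEval_add]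
      map_smul' := fun c p => by ext x; simp [polyEval_smul] }
  obtain ⟨C, hC, h⟩ := (polyInnerCore m (AxisCube.unit n)).exists_sq_norm_le S
  refine ⟨C, hC, fun p hp x hx => ?_⟩
  let v : V := ⟨p, (MvPolynomial.mem_restrictTotalDegree _ _ _).2 hp⟩
  have hv : RCLike.re ((polyInnerCore m (AxisCube.unit n)).inner v v)
      = ∫ y in (AxisCube.unit n).toSet, ‖polyEval p y‖ ^ 2 := by
    change RCLike.re (∫ y in (AxisCube.unit n).toSet, starRingEnd 𝕜 (polyEval p y) * polyEval p y)
      = _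
    rw [integral_conj_mul_self, RCLike.ofReal_re]
  calc ‖polyEval p x‖ ^ 2 ≤ ‖S v‖ ^ 2 := by gcongr; exact (S v).norm_coe_le_norm ⟨x, hx⟩
    _ ≤ _ := (h v).trans_eq (by rw [hv])

theorem AxisCube.integral_eq_integral_unit (Q : AxisCube n) (F : (Fin n → ℝ) → ℝ) :
    ∫ y in (AxisCube.unit n).toSet, F (Q.corner + Q.side • y)
      = (Q.side ^ n)⁻¹ * ∫ x in Q.toSet, F x := by
  have hQ := Q.side_pos
  have hmem (y : Fin n → ℝ) : y ∈ (AxisCube.unit n).toSet ↔ Q.corner + Q.side • y ∈ Q.toSet := by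
    simp only [toSet, AxisCube.unit, Set.mem_univ_pi, Set.mem_Ico, Pi.add_apply, Pi.smul_apply,
      smul_eq_mul, Pi.zero_apply, zero_add]
    refine forall_congr' fun i => and_congr ?_ ?_
    · rw [le_add_iff_nonneg_right, mul_nonneg_iff_of_pos_left hQ]
    · rw [add_lt_add_iff_left, mul_lt_iff_lt_one_right hQ]
  have hind : (AxisCube.unit n).toSet.indicator (fun y => F (Q.corner + Q.side • y))
      = fun y => (fun z => Q.toSet.indicator F (Q.corner + z)) (Q.side • y) := by
    funext y
    by_cases hy : y ∈ (AxisCube.unit n).toSet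
    · simp [hy, (hmem y).1 hy]
    · simp [hy, mt (hmem y).2 hy]
  rw [← integral_indicator (AxisCube.unit n).measurableSet_toSet, hind,
    Measure.integral_comp_smul_of_nonneg _ _ _ (hR := hQ.le), integral_add_left_eq_self (μ := volume)
      (Q.toSet.indicator F) Q.corner, integral_indicator Q.measurableSet_toSet]
  simp

theorem exists_sq_norm_polyEval_le (𝕜 : Type*) [RCLike 𝕜] (n m : ℕ) :
    ∃ C : ℝ, 0 < C ∧ ∀ (Q : AxisCube n) (p : MvPolynomial (Fin n) 𝕜), p.totalDegree ≤ m →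
      ∀ x ∈ Set.Icc Q.corner (fun i => Q.corner i + Q.side),
        ‖polyEval p x‖ ^ 2 ≤ C * ((Q.side ^ n)⁻¹ * ∫ y in Q.toSet, ‖polyEval p y‖ ^ 2) := by
  obtain ⟨C, hC, h⟩ := exists_sq_norm_polyEval_le_unit 𝕜 n m
  refine ⟨C, hC, fun Q p hp x hx => ?_⟩
  have hQ := Q.side_pos
  let F : Fin n → MvPolynomial (Fin n) 𝕜 := fun i =>
    MvPolynomial.C (Q.corner i : 𝕜) + MvPolynomial.C (Q.side : 𝕜) * MvPolynomial.X i
  have hF (i : Fin n) : (F i).totalDegree ≤ 1 := by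
    refine (MvPolynomial.totalDegree_add _ _).trans (max_le (by simp) ?_)
    refine (MvPolynomial.totalDegree_mul _ _).trans ?_
    simp
  have heval (y : Fin n → ℝ) :
      polyEval (MvPolynomial.bind₁ F p) y = polyEval p (Q.corner + Q.side • y) := by
    simp only [polyEval, MvPolynomial.eval, MvPolynomial.eval₂Hom_bind₁]
    congr 2
    funext i
    simp [F]
  have hy : (fun i => (x i - Q.corner i) / Q.side) ∈ Set.Icc (0 : Fin n → ℝ) 1 := by
    constructor
    · intro i
      exact div_nonneg (sub_nonneg.2 (hx.1 i)) hQ.le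
    · intro i
      exact (div_le_one hQ).2 (by linarith [hx.2 i])
  have hxy : (Q.corner + Q.side • fun i => (x i - Q.corner i) / Q.side) = x := by
    funext i
    simp only [Pi.add_apply, Pi.smul_apply, smul_eq_mul]
    field_simp
    ring
  have := h _ ((totalDegree_bind₁_le hF p).trans hp) _ hy
  simp only [heval] at this
  rwa [hxy, Q.integral_eq_integral_unit (fun x => ‖polyEval p x‖ ^ 2)] at this

/-- The projection onto polynomials of degree at most `m` is bounded from the normalized `L¹` norm to
the maximum norm, uniformly over all cubes. Testing the orthogonality against the conjugate
of `p` gives `∫ ‖p‖² ≤ sup ‖p‖ · ∫ ‖g‖`, and `sup ‖p‖²` is at most a multiple of the mean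
of `‖p‖²`. -/
theorem exists_norm_polyEval_le_of_isPolyProj (𝕜 : Type*) [RCLike 𝕜] (n m : ℕ) :
    ∃ C : ℝ, 0 < C ∧ ∀ (Q : AxisCube n) (g : (Fin n → ℝ) → 𝕜) (p : MvPolynomial (Fin n) 𝕜),
      IntegrableOn g Q.toSet → IsPolyProj m Q g p → ∀ x ∈ Q.toSet,
        ‖polyEval p x‖ ≤ C * ((Q.side ^ n)⁻¹ * ∫ y in Q.toSet, ‖g y‖) := by
  obtain ⟨C, hC, h⟩ := exists_sq_norm_polyEval_le 𝕜 n m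
  refine ⟨C, hC, fun Q g p hg hp x hx => ?_⟩
  have hQ := Q.side_pos
  obtain ⟨z, hz, hmax⟩ := (isCompact_Icc (a := Q.corner)
    (b := fun i => Q.corner i + Q.side)).exists_isMaxOn ⟨x, Q.toSet_subset_Icc hx⟩
      (continuous_polyEval p).norm.continuousOn
  have hle (y) (hy : y ∈ Q.toSet) : ‖polyEval p y‖ ≤ ‖polyEval p z‖ :=
    hmax (Q.toSet_subset_Icc hy)
  refine (hle x hx).trans ?_
  set M := ‖polyEval p z‖
  have hI : ∫ y in Q.toSet, ‖polyEval p y‖ ^ 2 ≤ M * ∫ y in Q.toSet, ‖g y‖ := by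
    have h0 := hp.2 _ ((totalDegree_conj_le p).trans hp.1)
    simp_rw [sub_mul] at h0
    rw [integral_sub (integrableOn_mul_polyEval hg _)
      (integrableOn_mul_polyEval (integrableOn_polyEval Q p) _), sub_eq_zero] at h0
    simp only [polyEval_conj] at h0
    have h1 : ((∫ y in Q.toSet, ‖polyEval p y‖ ^ 2 : ℝ) : 𝕜)
        = ∫ y in Q.toSet, g y * starRingEnd 𝕜 (polyEval p y) := by
      rw [h0, ← integral_conj_mul_self]
      simp only [mul_comm]
    have h2 : ∫ y in Q.toSet, ‖polyEval p y‖ ^ 2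
        = ‖∫ y in Q.toSet, g y * starRingEnd 𝕜 (polyEval p y)‖ := by
      rw [← h1, RCLike.norm_ofReal, abs_of_nonneg (integral_nonneg fun y => by positivity)]
    rw [h2, ← integral_const_mul]
    refine norm_integral_le_of_norm_le (hg.norm.const_mul M) ?_
    filter_upwards [ae_restrict_mem Q.measurableSet_toSet] with y hy
    rw [norm_mul, RCLike.norm_conj, mul_comm]
    exact mul_le_mul_of_nonneg_right (hle y hy) (norm_nonneg _)
  rcases (norm_nonneg (polyEval p z)).eq_or_lt with h0 | h0
  · change M ≤ _
    rw [show M = 0 from h0.symm]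
    have : 0 ≤ ∫ y in Q.toSet, ‖g y‖ := integral_nonneg fun y => norm_nonneg _
    positivity
  · refine le_of_mul_le_mul_left ?_ h0
    calc M * M = M ^ 2 := (sq M).symm
      _ ≤ C * ((Q.side ^ n)⁻¹ * ∫ y in Q.toSet, ‖polyEval p y‖ ^ 2) := h Q p hp.1 z hz
      _ ≤ C * ((Q.side ^ n)⁻¹ * (M * ∫ y in Q.toSet, ‖g y‖)) := by gcongr
      _ = M * (C * ((Q.side ^ n)⁻¹ * ∫ y in Q.toSet, ‖g y‖)) := by ring

/-- The bound for the projection in terms of extended nonnegative integrals. -/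
theorem exists_enorm_polyEval_le_of_isPolyProj (𝕜 : Type*) [RCLike 𝕜] (n m : ℕ) :
    ∃ C : ℝ≥0, ∀ (Q : AxisCube n) (g : (Fin n → ℝ) → 𝕜) (p : MvPolynomial (Fin n) 𝕜),
      IntegrableOn g Q.toSet → IsPolyProj m Q g p → ∀ x ∈ Q.toSet,
        ‖polyEval p x‖ₑ ≤ C * ((∫⁻ y in Q.toSet, ‖g y‖ₑ) / volume Q.toSet) := by
  obtain ⟨C, hC, h⟩ := exists_norm_polyEval_le_of_isPolyProj 𝕜 n m
  refine ⟨⟨C, hC.le⟩, fun Q g p hg hp x hx => ?_⟩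
  have hQ : 0 < Q.side ^ n := pow_pos Q.side_pos n
  have h1 := ENNReal.ofReal_le_ofReal (h Q g p hg hp x hx)
  rw [ofReal_norm, ENNReal.ofReal_mul hC.le, ENNReal.ofReal_mul (inv_pos.2 hQ).le,
    ENNReal.ofReal_inv_of_pos hQ, ofReal_integral_norm_eq_lintegral_enorm hg,
    ENNReal.ofReal_pow Q.side_pos.le] at h1
  rw [Q.volume_toSet, ENNReal.div_eq_inv_mul]
  convert h1 using 2
  exact (ENNReal.ofReal_eq_coe_nnreal hC.le).symm

end PolynomialBounds

/-! ### Stopping cubes -/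

namespace AxisCube

variable {n : ℕ} {Q : AxisCube n} {h : (Fin n → ℝ) → ℝ≥0∞} {c : ℝ≥0∞}

/-- The Calderón–Zygmund cubes of the function `h` on `Q` at height `c`: the first cubes, in the
sequence of dyadic cubes of increasing level around a point, over which the mean of `h` exceeds `c`.
Minimality is expressed by levels and not by inclusion, so that cubes of different levels
are distinguished also when `n = 0`. -/
def stoppingCubes (Q : AxisCube n) (h : (Fin n → ℝ) → ℝ≥0∞) (c : ℝ≥0∞) : Set (AxisCube n) :=
  {P | ∃ x ∈ Q.toSet, ∃ k, P = Q.cubeAt k x ∧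
    c < (∫⁻ y in P.toSet, h y) / volume P.toSet ∧
    ∀ l < k, (∫⁻ y in (Q.cubeAt l x).toSet, h y) / volume (Q.cubeAt l x).toSet ≤ c}

theorem stoppingCubes_subset_dyadic : Q.stoppingCubes h c ⊆ Q.dyadic := by
  rintro P ⟨x, hx, k, rfl, -, -⟩
  exact cubeAt_mem_dyadic hx k

theorem pairwiseDisjoint_stoppingCubes : (Q.stoppingCubes h c).PairwiseDisjoint toSet := by
  rintro P ⟨x, -, k, rfl, hk, hlt⟩ R ⟨y, -, l, rfl, hl, hlt'⟩ hne
  refine Set.disjoint_left.2 fun z hzP hzR => hne ?_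
  have key {x y : Fin n → ℝ} {k l : ℕ} (hzP : z ∈ (Q.cubeAt k x).toSet)
      (hzR : z ∈ (Q.cubeAt l y).toSet)
      (hk : c < (∫⁻ y in (Q.cubeAt k x).toSet, h y) / volume (Q.cubeAt k x).toSet)
      (hlt' : ∀ k < l, (∫⁻ z in (Q.cubeAt k y).toSet, h z) / volume (Q.cubeAt k y).toSet ≤ c) :
      l ≤ k := by
    by_contra! hkl
    have : Q.cubeAt k x = Q.cubeAt k y := by
      rw [← cubeAt_eq_of_mem hzP, cubeAt_eq_of_mem (Q.cubeAt_subset_of_le hkl.le y hzR)]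
    rw [this] at hk
    exact (hlt' k hkl).not_gt hk
  obtain rfl : k = l := le_antisymm (key hzR hzP hl hlt) (key hzP hzR hk hlt')
  rw [← cubeAt_eq_of_mem hzP, cubeAt_eq_of_mem hzR]

theorem mul_tsum_volume_stoppingCubes_le :
    c * ∑' P : Q.stoppingCubes h c, volume (P : AxisCube n).toSet ≤ ∫⁻ y in Q.toSet, h y := by
  rw [← ENNReal.tsum_mul_left]
  calc ∑' P : Q.stoppingCubes h c, c * volume (P : AxisCube n).toSet
      ≤ ∑' P : Q.stoppingCubes h c, ∫⁻ y in (P : AxisCube n).toSet, h y := by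
        refine ENNReal.tsum_le_tsum fun P => ?_
        obtain ⟨x, -, k, -, hc, -⟩ := P.2
        exact (ENNReal.le_div_iff_mul_le (Or.inl (volume_toSet_pos _))
          (Or.inl (volume_toSet_ne_top _))).1 hc.le
    _ = ∫⁻ y in ⋃ P ∈ Q.stoppingCubes h c, P.toSet, h y :=
        (lintegral_biUnion (Q.countable_dyadic.mono stoppingCubes_subset_dyadic)
          (fun P _ => P.measurableSet_toSet) pairwiseDisjoint_stoppingCubes h).symm
    _ ≤ ∫⁻ y in Q.toSet, h y := lintegral_mono_set (Set.iUnion₂_subset fun P hP =>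
        toSet_subset_of_mem_dyadic (stoppingCubes_subset_dyadic hP))

/-- A stopping cube is not `Q`, and its parent has not been stopped. -/
theorem laverage_le_of_mem_stoppingCubes (hQ : (∫⁻ y in Q.toSet, h y) / volume Q.toSet ≤ c)
    {P : AxisCube n} (hP : P ∈ Q.stoppingCubes h c) :
    (∫⁻ y in P.toSet, h y) / volume P.toSet ≤ 2 ^ n * c := by
  obtain ⟨x, hx, k, rfl, hc, hlt⟩ := hP
  cases k with
  | zero => rw [cubeAt_zero hx] at hc; exact absurd hQ hc.not_ge
  | succ k =>
    have h1 := hlt k k.lt_succ_self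
    rw [ENNReal.div_le_iff (volume_toSet_pos _) (volume_toSet_ne_top _), volume_cubeAt] at h1
    rw [ENNReal.div_le_iff (volume_toSet_pos _) (volume_toSet_ne_top _)]
    calc _ ≤ _ := lintegral_mono_set (Q.cubeAt_subset_of_le k.le_succ x)
      _ ≤ _ := h1
      _ = _ := by ring

theorem laverage_cubeAt_le_of_notMem {x : Fin n → ℝ} (hx : x ∈ Q.toSet)
    (hnot : ∀ P ∈ Q.stoppingCubes h c, x ∉ P.toSet) (k : ℕ) :
    (∫⁻ y in (Q.cubeAt k x).toSet, h y) / volume (Q.cubeAt k x).toSet ≤ c := by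
  induction k using Nat.strong_induction_on with
  | _ k ih =>
    by_contra! hc
    exact hnot _ ⟨x, hx, k, rfl, hc, ih⟩ (Q.mem_cubeAt_self k x)

theorem ae_enorm_le_of_notMem_stoppingCubes {E : Type*} [NormedAddCommGroup E] (Q : AxisCube n)
    {g : (Fin n → ℝ) → E} (hg : LocallyIntegrable g) (c : ℝ≥0∞) :
    ∀ᵐ x, x ∈ Q.toSet → (∀ P ∈ Q.stoppingCubes (fun y => ‖g y‖ₑ) c, x ∉ P.toSet) →
      ‖g x‖ₑ ≤ c := by
  filter_upwards [Q.ae_tendsto_average_cubeAt fun z => (hg z).norm] with x hlim hx hnot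
  rw [← ofReal_norm]
  refine le_of_tendsto' (ENNReal.tendsto_ofReal hlim) fun k => ?_
  refine le_trans (le_of_eq ?_) (laverage_cubeAt_le_of_notMem hx hnot k)
  set P := Q.cubeAt k x
  have hint : IntegrableOn g P.toSet :=
    (hg.integrableOn_isCompact isCompact_Icc).mono_set P.toSet_subset_Icc
  have hpos : 0 < (volume P.toSet).toReal :=
    ENNReal.toReal_pos P.volume_toSet_pos P.volume_toSet_ne_top
  rw [setAverage_eq, smul_eq_mul, measureReal_def, ENNReal.ofReal_mul (inv_pos.2 hpos).le,
    ENNReal.ofReal_inv_of_pos hpos, ENNReal.ofReal_toReal P.volume_toSet_ne_top,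
    ofReal_integral_norm_eq_lintegral_enorm hint, ENNReal.div_eq_inv_mul]

end AxisCube

/-! ### One step of the decomposition -/

section Decomposition

variable {n : ℕ} {𝕜 : Type*} [RCLike 𝕜]

theorem integrableOn_toSet {f : (Fin n → ℝ) → 𝕜} (hf : LocallyIntegrable f) (Q : AxisCube n) :
    IntegrableOn f Q.toSet :=
  (hf.integrableOn_isCompact isCompact_Icc).mono_set Q.toSet_subset_Icc

theorem locallyIntegrable_sub_polyEval {f : (Fin n → ℝ) → 𝕜} (hf : LocallyIntegrable f)
    (p : MvPolynomial (Fin n) 𝕜) : LocallyIntegrable (fun x => f x - polyEval p x) :=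
  hf.sub (continuous_polyEval p).locallyIntegrable

/-- The polynomial by which the projections of `f` on two cubes differ is itself
a projection on the second cube. -/
theorem isPolyProj_polyProj_sub {f : (Fin n → ℝ) → 𝕜} (hf : LocallyIntegrable f) (m : ℕ)
    (Q P : AxisCube n) :
    IsPolyProj m P (fun x => f x - polyEval (polyProj m Q f) x)
      (polyProj m P f - polyProj m Q f) := by
  have hP := isPolyProj_polyProj m P (integrableOn_toSet hf P)
  have hQ := isPolyProj_polyProj m Q (integrableOn_toSet hf Q)
  refine ⟨(MvPolynomial.totalDegree_sub _ _).trans (max_le hP.1 hQ.1), fun q hq => ?_⟩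
  simpa only [polyEval_sub, sub_sub_sub_cancel_right] using hP.2 q hq

/-- The bad cubes of `f` on `Q`: the stopping cubes of `f - P_Q f` at height `2 a(Q)`. -/
noncomputable def badCubes (m : ℕ) (f : (Fin n → ℝ) → 𝕜) (a : AxisCube n → ℝ≥0)
    (Q : AxisCube n) : Set (AxisCube n) :=
  Q.stoppingCubes (fun x => ‖f x - polyEval (polyProj m Q f) x‖ₑ) (2 * a Q)

theorem tsum_volume_badCubes_le {m : ℕ} {f : (Fin n → ℝ) → 𝕜} {a : AxisCube n → ℝ≥0}
    {Q : AxisCube n}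
    (ha : (∫⁻ x in Q.toSet, ‖f x - polyEval (polyProj m Q f) x‖ₑ) / volume Q.toSet ≤ a Q) :
    ∑' P : badCubes m f a Q, volume (P : AxisCube n).toSet ≤ volume Q.toSet / 2 := by
  rw [ENNReal.div_le_iff Q.volume_toSet_pos Q.volume_toSet_ne_top] at ha
  rcases eq_or_ne (a Q) 0 with h0 | h0
  · -- the mean oscillation on `Q` vanishes, and no cube is stopped at height zero
    have hempty : badCubes m f a Q = ∅ := by
      refine Set.eq_empty_of_forall_notMem fun P hP => ?_
      have hsub := AxisCube.toSet_subset_of_mem_dyadic (AxisCube.stoppingCubes_subset_dyadic hP)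
      obtain ⟨x, -, k, -, hc, -⟩ := hP
      have h1 := (lintegral_mono_set (f := fun x => ‖f x - polyEval (polyProj m Q f) x‖ₑ)
        (μ := volume) hsub).trans ha
      rw [h0, ENNReal.coe_zero, zero_mul, nonpos_iff_eq_zero] at h1
      rw [h1, ENNReal.zero_div] at hc
      exact not_lt_bot hc
    rw [hempty]
    simp
  · have h1 := (AxisCube.mul_tsum_volume_stoppingCubes_le (Q := Q)
      (h := fun x => ‖f x - polyEval (polyProj m Q f) x‖ₑ) (c := 2 * a Q)).trans ha
    have h0' : (a Q : ℝ≥0∞) ≠ 0 := by exact_mod_cast h0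
    have hcomm (t : ℝ≥0∞) : 2 * a Q * t = a Q * (2 * t) := by ring
    rw [hcomm, ENNReal.mul_le_mul_iff_right h0' ENNReal.coe_ne_top] at h1
    rw [ENNReal.le_div_iff_mul_le (by simp) (by simp), mul_comm]
    exact h1

/-- One step of the decomposition. Outside the bad cubes `f - P_Q f` is at most `2 a(Q)`. On a bad
cube `P`, the difference `P_P f - P_Q f` is the projection of `f - P_Q f` on `P`, and hence is
bounded by the mean of `|f - P_Q f|` over `P`, which is at most `2ⁿ` times the mean over
the parent of `P`. -/
theorem exists_ae_enorm_sub_polyProj_le (𝕜 : Type*) [RCLike 𝕜] (n m : ℕ) :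
    ∃ C : ℝ≥0, 0 < C ∧ ∀ (f : (Fin n → ℝ) → 𝕜), LocallyIntegrable f →
      ∀ (a : AxisCube n → ℝ≥0) (Q : AxisCube n),
      (∫⁻ x in Q.toSet, ‖f x - polyEval (polyProj m Q f) x‖ₑ) / volume Q.toSet ≤ a Q →
      ∀ᵐ x, x ∈ Q.toSet →
        ‖f x - polyEval (polyProj m Q f) x‖ₑ ≤ C * a Q ∨
        ∃ P ∈ badCubes m f a Q, x ∈ P.toSet ∧
          ‖f x - polyEval (polyProj m Q f) x‖ₑ
            ≤ C * a Q + ‖f x - polyEval (polyProj m P f) x‖ₑ := by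
  obtain ⟨C, hC⟩ := exists_enorm_polyEval_le_of_isPolyProj 𝕜 n m
  refine ⟨2 + C * (2 ^ n * 2), by positivity, fun f hf a Q ha => ?_⟩
  have hg := locallyIntegrable_sub_polyEval hf (polyProj m Q f)
  have hcoe : ((2 + C * (2 ^ n * 2) : ℝ≥0) : ℝ≥0∞) = 2 + C * (2 ^ n * 2) := by push_cast; rfl
  rw [hcoe]
  filter_upwards [Q.ae_enorm_le_of_notMem_stoppingCubes hg (2 * a Q)] with x hx hxQ
  by_cases hbad : ∃ P ∈ badCubes m f a Q, x ∈ P.toSet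
  · right
    obtain ⟨P, hP, hxP⟩ := hbad
    refine ⟨P, hP, hxP, ?_⟩
    have hle : (a Q : ℝ≥0∞) ≤ 2 * a Q := by rw [two_mul]; exact le_self_add
    have h1 := hC P _ _ (integrableOn_toSet hg P) (isPolyProj_polyProj_sub hf m Q P) x hxP
    have h2 : ‖polyEval (polyProj m P f - polyProj m Q f) x‖ₑ ≤ C * (2 ^ n * (2 * a Q)) :=
      h1.trans (by gcongr; exact AxisCube.laverage_le_of_mem_stoppingCubes (ha.trans hle) hP)
    calc ‖f x - polyEval (polyProj m Q f) x‖ₑ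
        = ‖polyEval (polyProj m P f - polyProj m Q f) x
            + (f x - polyEval (polyProj m P f) x)‖ₑ := by
          rw [polyEval_sub]; congr 1; ring
      _ ≤ C * (2 ^ n * (2 * a Q)) + ‖f x - polyEval (polyProj m P f) x‖ₑ :=
          (enorm_add_le _ _).trans (by gcongr)
      _ ≤ (2 + C * (2 ^ n * 2)) * a Q + ‖f x - polyEval (polyProj m P f) x‖ₑ := by
          gcongr ?_ + _
          rw [add_mul]
          exact le_add_left (by rw [mul_assoc, mul_assoc])
  · left
    push Not at hbad
    refine (hx hxQ hbad).trans ?_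
    gcongr
    exact le_self_add

end Decomposition

/-! ### Iteration of the stopping procedure -/

section Iteration

variable {n : ℕ} {𝕜 : Type*} [RCLike 𝕜]

/-- The `k`-th generation of bad cubes, starting from the single cube `Q`. -/
noncomputable def badGeneration (m : ℕ) (f : (Fin n → ℝ) → 𝕜) (a : AxisCube n → ℝ≥0)
    (Q : AxisCube n) : ℕ → Set (AxisCube n)
  | 0 => {Q}
  | k + 1 => ⋃ P ∈ badGeneration m f a Q k, badCubes m f a P

variable {m : ℕ} {f : (Fin n → ℝ) → 𝕜} {a : AxisCube n → ℝ≥0} {Q : AxisCube n}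

theorem badCubes_subset_dyadic : badCubes m f a Q ⊆ Q.dyadic :=
  AxisCube.stoppingCubes_subset_dyadic

theorem badGeneration_subset_dyadic (k : ℕ) : badGeneration m f a Q k ⊆ Q.dyadic := by
  induction k with
  | zero => exact Set.singleton_subset_iff.2 Q.self_mem_dyadic
  | succ k ih =>
    exact Set.iUnion₂_subset fun P hP R hR =>
      AxisCube.dyadic_trans (ih hP) (badCubes_subset_dyadic hR)

theorem countable_badGeneration (k : ℕ) : (badGeneration m f a Q k).Countable :=
  Q.countable_dyadic.mono (badGeneration_subset_dyadic k)

theorem pairwiseDisjoint_badGeneration (k : ℕ) :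
    (badGeneration m f a Q k).PairwiseDisjoint AxisCube.toSet := by
  induction k with
  | zero => exact Set.pairwiseDisjoint_singleton _ _
  | succ k ih =>
    intro R hR R' hR' hne
    obtain ⟨P, hP, hRP⟩ := Set.mem_iUnion₂.1 hR
    obtain ⟨P', hP', hRP'⟩ := Set.mem_iUnion₂.1 hR'
    rcases eq_or_ne P P' with rfl | hPP
    · exact AxisCube.pairwiseDisjoint_stoppingCubes hRP hRP' hne
    · exact (ih hP hP' hPP).mono
        (AxisCube.toSet_subset_of_mem_dyadic (badCubes_subset_dyadic hRP))
        (AxisCube.toSet_subset_of_mem_dyadic (badCubes_subset_dyadic hRP'))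

theorem tsum_volume_badGeneration_le
    (ha : ∀ Q : AxisCube n,
      (∫⁻ x in Q.toSet, ‖f x - polyEval (polyProj m Q f) x‖ₑ) / volume Q.toSet ≤ a Q) (k : ℕ) :
    ∑' P : badGeneration m f a Q k, volume (P : AxisCube n).toSet
      ≤ (1 / 2) ^ k * volume Q.toSet := by
  induction k with
  | zero =>
    simp [badGeneration]
  | succ k ih =>
    calc ∑' P : badGeneration m f a Q (k + 1), volume (P : AxisCube n).toSet
        ≤ ∑' P : badGeneration m f a Q k, ∑' R : badCubes m f a P,
            volume (R : AxisCube n).toSet :=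
          ENNReal.tsum_biUnion_le_tsum (fun R : AxisCube n => volume R.toSet) _ _
      _ ≤ ∑' P : badGeneration m f a Q k, 1 / 2 * volume (P : AxisCube n).toSet := by
          refine ENNReal.tsum_le_tsum fun P => (tsum_volume_badCubes_le (ha P)).trans_eq ?_
          rw [ENNReal.div_eq_inv_mul, one_div]
      _ ≤ 1 / 2 * ((1 / 2) ^ k * volume Q.toSet) := by
          rw [ENNReal.tsum_mul_left]; gcongr
      _ = (1 / 2) ^ (k + 1) * volume Q.toSet := by rw [pow_succ]; ring

/-- The function `∑ a(P) χ_P`, the sum being over the `k`-th generation of bad cubes. -/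
noncomputable def badSum (m : ℕ) (f : (Fin n → ℝ) → 𝕜) (a : AxisCube n → ℝ≥0) (Q : AxisCube n)
    (k : ℕ) (x : Fin n → ℝ) : ℝ≥0∞ :=
  ∑' P : badGeneration m f a Q k, (P : AxisCube n).toSet.indicator (fun _ => (a P : ℝ≥0∞)) x

theorem measurable_badSum (k : ℕ) : Measurable (badSum m f a Q k) := by
  have := (countable_badGeneration (m := m) (f := f) (a := a) (Q := Q) k).to_subtype
  exact Measurable.tsum fun P => measurable_const.indicator P.1.measurableSet_toSet

theorem le_badSum {k : ℕ} {P : AxisCube n} (hP : P ∈ badGeneration m f a Q k) {x : Fin n → ℝ}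
    (hx : x ∈ P.toSet) : (a P : ℝ≥0∞) ≤ badSum m f a Q k x := by
  have h := ENNReal.le_tsum (f := fun P : badGeneration m f a Q k =>
    (P : AxisCube n).toSet.indicator (fun _ => (a P : ℝ≥0∞)) x) ⟨P, hP⟩
  rwa [Set.indicator_of_mem hx] at h

/-- Almost every point lies in no bad cube of high generation. -/
theorem ae_exists_notMem_badGeneration
    (ha : ∀ Q : AxisCube n,
      (∫⁻ x in Q.toSet, ‖f x - polyEval (polyProj m Q f) x‖ₑ) / volume Q.toSet ≤ a Q) :
    ∀ᵐ x, ∃ k, ∀ P ∈ badGeneration m f a Q k, x ∉ P.toSet := by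
  have hnull : volume (⋂ k, ⋃ P ∈ badGeneration m f a Q k, P.toSet) = 0 := by
    have hlim : Filter.Tendsto (fun k : ℕ => (1 / 2 : ℝ≥0∞) ^ k * volume Q.toSet) Filter.atTop
        (nhds 0) := by
      have := ENNReal.Tendsto.mul_const (ENNReal.tendsto_pow_atTop_nhds_zero_of_lt_one
        (r := 1 / 2) (by simp)) (Or.inr Q.volume_toSet_ne_top)
      rwa [zero_mul] at this
    refine nonpos_iff_eq_zero.1 (ge_of_tendsto' hlim fun k => ?_)
    exact (measure_mono (Set.iInter_subset _ k)).trans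
      ((measure_biUnion_le _ (countable_badGeneration k) _).trans
        (tsum_volume_badGeneration_le ha k))
  filter_upwards [measure_eq_zero_iff_ae_notMem.1 hnull] with x hx
  simpa using hx

/-- The sparse pointwise bound of `f - P_Q f` by the bad cubes of all generations. -/
theorem exists_ae_enorm_sub_polyProj_le_tsum (𝕜 : Type*) [RCLike 𝕜] (n m : ℕ) :
    ∃ C : ℝ≥0, 0 < C ∧ ∀ (f : (Fin n → ℝ) → 𝕜), LocallyIntegrable f →
      ∀ (a : AxisCube n → ℝ≥0),
      (∀ Q : AxisCube n,
        (∫⁻ x in Q.toSet, ‖f x - polyEval (polyProj m Q f) x‖ₑ) / volume Q.toSet ≤ a Q) →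
      ∀ Q : AxisCube n, ∀ᵐ x, x ∈ Q.toSet →
        ‖f x - polyEval (polyProj m Q f) x‖ₑ ≤ C * ∑' k, badSum m f a Q k x := by
  obtain ⟨C, hC0, hC⟩ := exists_ae_enorm_sub_polyProj_le 𝕜 n m
  refine ⟨C, hC0, fun f hf a ha Q => ?_⟩
  have hstep := (ae_ball_iff Q.countable_dyadic).2 fun P _ => hC f hf a P (ha P)
  filter_upwards [hstep, ae_exists_notMem_badGeneration (Q := Q) ha] with x hx hbad hxQ
  have key (k : ℕ) :
      ‖f x - polyEval (polyProj m Q f) x‖ₑ ≤ C * ∑ i ∈ Finset.range k, badSum m f a Q i x ∨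
      ∃ P ∈ badGeneration m f a Q k, x ∈ P.toSet ∧
        ‖f x - polyEval (polyProj m Q f) x‖ₑ ≤ C * ∑ i ∈ Finset.range k, badSum m f a Q i x
          + ‖f x - polyEval (polyProj m P f) x‖ₑ := by
    induction k with
    | zero => exact Or.inr ⟨Q, rfl, hxQ, by simp⟩
    | succ k ih =>
      rw [Finset.sum_range_succ, mul_add]
      rcases ih with ih | ⟨P, hP, hxP, ih⟩
      · exact Or.inl (ih.trans le_self_add)
      · have haP : C * (a P : ℝ≥0∞) ≤ C * badSum m f a Q k x := by
          gcongr; exact le_badSum hP hxP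
        rcases hx P (badGeneration_subset_dyadic k hP) hxP with h | ⟨R, hR, hxR, h⟩
        · exact Or.inl (ih.trans (by gcongr; exact h.trans haP))
        · refine Or.inr ⟨R, Set.mem_iUnion₂.2 ⟨P, hP, hR⟩, hxR, ih.trans ?_⟩
          rw [add_assoc]
          gcongr
          exact h.trans (by gcongr)
  obtain ⟨k, hk⟩ := hbad
  rcases key k with h | ⟨P, hP, hxP, -⟩
  · exact h.trans (by gcongr; exact ENNReal.sum_le_tsum _)
  · exact absurd hxP (hk P hP)

end Iteration

/-! ### Summation over the generations -/

/-- Each of the intervals `(2⁻⁽ᵏ⁺¹⁾, 2⁻ᵏ]` contributes at least `φ(2⁻⁽ᵏ⁺¹⁾) / 2` to the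
integral. -/
theorem tsum_le_two_mul_lintegral_div {φ : ℝ → ℝ≥0} (hφ : MonotoneOn φ (Set.Icc 0 1)) :
    ∑' k : ℕ, (φ ((1 / 2) ^ (k + 1)) : ℝ≥0∞)
      ≤ 2 * ∫⁻ t in Set.Ioc (0 : ℝ) 1, (φ t : ℝ≥0∞) / ENNReal.ofReal t := by
  have hanti : Antitone fun k : ℕ => (1 / 2 : ℝ) ^ k :=
    pow_right_anti₀ (by norm_num) (by norm_num)
  let I : ℕ → Set ℝ := fun k => Set.Ioc ((1 / 2 : ℝ) ^ (k + 1)) ((1 / 2) ^ k)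
  have hdisj : Pairwise (Function.onFun Disjoint I) := hanti.pairwise_disjoint_on_Ioc_succ
  have hsub : ⋃ k, I k ⊆ Set.Ioc (0 : ℝ) 1 := Set.iUnion_subset fun k t ht =>
    ⟨lt_trans (by positivity) ht.1, ht.2.trans (pow_le_one₀ (by norm_num) (by norm_num))⟩
  have hI (k : ℕ) : (φ ((1 / 2) ^ (k + 1)) : ℝ≥0∞)
      ≤ 2 * ∫⁻ t in I k, (φ t : ℝ≥0∞) / ENNReal.ofReal t := by
    have hpos : (0 : ℝ) < (1 / 2) ^ k := by positivity
    have hlen : (1 / 2 : ℝ) ^ k - (1 / 2) ^ (k + 1) = (1 / 2) ^ k / 2 := by rw [pow_succ]; ring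
    have hconst : ∫⁻ _ in I k, (φ ((1 / 2) ^ (k + 1)) : ℝ≥0∞) / ENNReal.ofReal ((1 / 2) ^ k)
        = φ ((1 / 2) ^ (k + 1)) / 2 := by
      rw [setLIntegral_const, Real.volume_Ioc, hlen,
        ENNReal.ofReal_div_of_pos two_pos, ENNReal.ofReal_ofNat]
      have h0 : ENNReal.ofReal ((1 / 2 : ℝ) ^ k) ≠ 0 := by
        rwa [Ne, ENNReal.ofReal_eq_zero, not_le]
      rw [← mul_div_assoc, ENNReal.div_mul_cancel h0 ENNReal.ofReal_ne_top]
    calc (φ ((1 / 2) ^ (k + 1)) : ℝ≥0∞)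
        = 2 * (φ ((1 / 2) ^ (k + 1)) / 2) :=
          (ENNReal.mul_div_cancel two_ne_zero ENNReal.ofNat_ne_top).symm
      _ ≤ _ := by
          rw [← hconst]
          gcongr 2 * ?_
          refine setLIntegral_mono' measurableSet_Ioc fun t ht => ?_
          have ht1 : t ∈ Set.Ioc (0 : ℝ) 1 := hsub (Set.mem_iUnion.2 ⟨k, ht⟩)
          gcongr
          · exact hφ ⟨by positivity, pow_le_one₀ (by norm_num) (by norm_num)⟩
              ⟨ht1.1.le, ht1.2⟩ ht.1.le
          · exact ht.2
  calc ∑' k : ℕ, (φ ((1 / 2) ^ (k + 1)) : ℝ≥0∞)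
      ≤ ∑' k, 2 * ∫⁻ t in I k, (φ t : ℝ≥0∞) / ENNReal.ofReal t := ENNReal.tsum_le_tsum hI
    _ = 2 * ∫⁻ t in ⋃ k, I k, (φ t : ℝ≥0∞) / ENNReal.ofReal t := by
        rw [ENNReal.tsum_mul_left, lintegral_iUnion (fun k => measurableSet_Ioc) hdisj]
    _ ≤ _ := by gcongr

theorem badSum_norm_le {n m : ℕ} {𝕜 : Type*} [RCLike 𝕜] {f : (Fin n → ℝ) → 𝕜}
    {μ : AxisCube n → Measure (Fin n → ℝ)} {X : ∀ Q, BanachFunctionNorm (μ Q)} {φ : ℝ → ℝ≥0}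
    {a : AxisCube n → ℝ≥0} (hφ : MonotoneOn φ (Set.Icc 0 1)) (hX : SmallnessPreserving X φ a)
    (ha : ∀ Q : AxisCube n,
      (∫⁻ x in Q.toSet, ‖f x - polyEval (polyProj m Q f) x‖ₑ) / volume Q.toSet ≤ a Q)
    (Q : AxisCube n) (k : ℕ) :
    X Q (badSum m f a Q k) ≤ φ ((1 / 2) ^ k) * a Q := by
  refine (hX Q _ (badGeneration_subset_dyadic k) (pairwiseDisjoint_badGeneration k)).trans ?_
  gcongr
  have h1 : (∑' P : badGeneration m f a Q k, volume (P : AxisCube n).toSet) / volume Q.toSet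
      ≤ (1 / 2) ^ k :=
    (ENNReal.div_le_iff Q.volume_toSet_pos Q.volume_toSet_ne_top).2
      (tsum_volume_badGeneration_le ha k)
  have h2 := ENNReal.toReal_mono (by finiteness) h1
  rw [ENNReal.toReal_pow, show (1 / 2 : ℝ≥0∞).toReal = 1 / 2 by simp] at h2
  have h3 : (1 / 2 : ℝ) ^ k ≤ 1 := pow_le_one₀ (by norm_num) (by norm_num)
  exact hφ ⟨ENNReal.toReal_nonneg, h2.trans h3⟩ ⟨by positivity, h3⟩ h2

theorem theorem5p3 (𝕜 : Type*) [RCLike 𝕜] (n m : ℕ) :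
    ∃ C : ℝ≥0, 0 < C ∧
      ∀ (f : (Fin n → ℝ) → 𝕜), LocallyIntegrable f →
      ∀ (μ : AxisCube n → Measure (Fin n → ℝ)), (∀ Q, μ Q ≪ volume) →
      ∀ (X : ∀ Q, BanachFunctionNorm (μ Q)) (φ : ℝ → ℝ≥0) (a : AxisCube n → ℝ≥0),
        MonotoneOn φ (Set.Icc 0 1) →
        SmallnessPreserving X φ a →
        (∀ Q : AxisCube n,
          (∫⁻ x in Q.toSet, ‖f x - polyEval (polyProj m Q f) x‖ₑ) / volume Q.toSet ≤ a Q) →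
        ∀ Q : AxisCube n,
          X Q (Q.toSet.indicator fun x => ‖f x - polyEval (polyProj m Q f) x‖ₑ) ≤
            C * a Q * ((∫⁻ t in Set.Ioc (0 : ℝ) 1, (φ t : ℝ≥0∞) / ENNReal.ofReal t) + φ 1) := by
  obtain ⟨C, hC0, hC⟩ := exists_ae_enorm_sub_polyProj_le_tsum 𝕜 n m
  refine ⟨C * 2, by positivity, fun f hf μ hμ X φ a hφ hX ha Q => ?_⟩
  have hmeas : AEMeasurable (Q.toSet.indicator fun x => ‖f x - polyEval (polyProj m Q f) x‖ₑ)
      (μ Q) :=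
    (((locallyIntegrable_sub_polyEval hf _).aestronglyMeasurable.mono_ac (hμ Q)).enorm).indicator
      Q.measurableSet_toSet
  have hsum : Measurable fun x => ∑' k, badSum m f a Q k x :=
    Measurable.tsum fun k => measurable_badSum k
  have hae : (Q.toSet.indicator fun x => ‖f x - polyEval (polyProj m Q f) x‖ₑ) ≤ᵐ[μ Q]
      fun x => C * ∑' k, badSum m f a Q k x := by
    filter_upwards [(hμ Q).ae_le (hC f hf a ha Q)] with x hx
    by_cases hxQ : x ∈ Q.toSet
    · rw [Set.indicator_of_mem hxQ]; exact hx hxQ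
    · rw [Set.indicator_of_notMem hxQ]; exact zero_le
  calc X Q (Q.toSet.indicator fun x => ‖f x - polyEval (polyProj m Q f) x‖ₑ)
      ≤ X Q fun x => C * ∑' k, badSum m f a Q k x :=
        (X Q).mono _ _ hmeas (hsum.const_mul _).aemeasurable hae
    _ = C * X Q fun x => ∑' k, badSum m f a Q k x := (X Q).smul_eq C _ hsum.aemeasurable
    _ ≤ C * ∑' k, X Q (badSum m f a Q k) := by
        gcongr
        exact (X Q).tsum_le fun k => (measurable_badSum k).aemeasurable
    _ ≤ C * ∑' k : ℕ, φ ((1 / 2) ^ k) * (a Q : ℝ≥0∞) := by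
        gcongr with k
        exact badSum_norm_le hφ hX ha Q k
    _ = C * a Q * ∑' k : ℕ, (φ ((1 / 2) ^ k) : ℝ≥0∞) := by
        rw [ENNReal.tsum_mul_right]; ring
    _ = C * a Q * (φ 1 + ∑' k : ℕ, (φ ((1 / 2) ^ (k + 1)) : ℝ≥0∞)) := by
        rw [tsum_eq_zero_add' ENNReal.summable, pow_zero]
    _ ≤ C * a Q * (2 * φ 1
          + 2 * ∫⁻ t in Set.Ioc (0 : ℝ) 1, (φ t : ℝ≥0∞) / ENNReal.ofReal t) := by
        gcongr
        · rw [two_mul]; exact le_self_add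
        · exact tsum_le_two_mul_lintegral_div hφ
    _ = _ := by push_cast; ring
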